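/- Fix a countable non-empty set $\mathit{At}$ of atoms. **Clauses.** Propositional formulas are built from $\top$ and atoms by $\neg,\wedge$. A *clause* is a finite (possibly empty) set $D$ of literals $p,\neg p$, read as $\bigvee D$; it is *tautological* if $\{p,\neg p\}\subseteq D$ for some atom $p$. For a propositional formula $\pi$, let $\mathcal C(\pi)$ be the (finite) set of all non-tautological clauses $D$ such that $\pi\to\bigvee D$ is a tautology and $\pi\to\bigvee D'$ is not a tautology for any $D'\subsetneq D$. **Language.** Let $\mathcal L_{\Box\ddagger AM_D}$ be the set of formulas $$\varphi::=\top\mid p\mid\neg\varphi\mid\varphi\wedge\varphi\mid\Box\varphi\mid[\ddagger\pi]\varphi\mid[D_1,D_2]_i\,\varphi ,$$ where $p\in\mathit{At}$, $\pi$ is propositional, $D_1,D_2$ are non-tautological clauses and $i\in\{0,1,2\}$ (the other connectives are defined as usual, an empty conjunction being $\top$), and let $\mathcal L_{\Box\ddagger}$ be the set of those in which no $[D_1,D_2]_i$ occurs. **Semantics.** A model is $M=\langle W,R,V\rangle$ with $W\neq\varnothing$, $R\subseteq W\times W$, $V:\mathit{At}\to\mathcal P(W)$. For non-tautological clauses $D_1,D_2$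 the model $M^{D_1,D_2}$ has the worlds $W\times\{0,1,2\}$ and the relation $(w,i)R'(v,j)\iff wRv$; moreover $(w,0)\in V'(p)\iff w\in V(p)$, and for $i\in\{1,2\}$, $(w,i)\in V'(p)$ iff $\neg p\in D_i$, or $\{p,\neg p\}\cap D_i=\varnothing$ and $w\in V(p)$. Satisfaction is as usual for $\top$, atoms, $\neg,\wedge,\Box$; $M,w\models[\ddagger\pi]\varphi$ iff $M^{D_1,D_2},(w,0)\models\varphi$ for all $D_1\in\mathcal C(\pi)$ and $D_2\in\mathcal C(\neg\pi)$; and $M,w\models[D_1,D_2]_i\varphi$ iff $M^{D_1,D_2},(w,i)\models\varphi$. **Logics.** Let $\Lambda\in\{K,T,K4,K5,S4,S5\}$. A model is *$\Lambda$-complying* if its relation is, respectively, arbitrary, reflexive, transitive, Euclidean, reflexive and transitive, an equivalence relation. A formula is valid over the $\Lambda$-complying models if it holds at every world of each of them. **Axiom system.** The system $\Lambda+\mathrm{Ax}_{\Box\ddagger AM_D}$ has, for formulas of $\mathcal L_{\Box\ddagger AM_D}$: all instances of propositional tautologies; $\Box(\varphi\to\psi)\to(\Box\varphi\to\Box\psi)$;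 modus ponens; from $\varphi$ infer $\Box\varphi$; the axioms $\Box\varphi\to\varphi$ (for $T,S4,S5$), $\Box\varphi\to\Box\Box\varphi$ (for $K4,S4,S5$), $\neg\Box\varphi\to\Box\neg\Box\varphi$ (for $K5,S5$); and, for all $i\in\{0,1,2\}$, - $[\ddagger\pi]\varphi\leftrightarrow\bigwedge_{D_1\in\mathcal C(\pi)}\bigwedge_{D_2\in\mathcal C(\neg\pi)}[D_1,D_2]_0\varphi$; - $[D_1,D_2]_0\,p\leftrightarrow p$; and for $j\in\{1,2\}$: $[D_1,D_2]_j\,p\leftrightarrow p$ if $\{p,\neg p\}\cap D_j=\varnothing$, $[D_1,D_2]_j\,p\leftrightarrow\top$ if $\neg p\in D_j$, $[D_1,D_2]_j\,p\leftrightarrow\bot$ if $p\in D_j$; - $[D_1,D_2]_i\neg\varphi\leftrightarrow\neg[D_1,D_2]_i\varphi$; - $[D_1,D_2]_i(\varphi\wedge\psi)\leftrightarrow([D_1,D_2]_i\varphi\wedge[D_1,D_2]_i\psi)$; - $[D_1,D_2]_i\Box\varphi\leftrightarrow\Box([D_1,D_2]_0\varphi\wedge[D_1,D_2]_1\varphi\wedge[D_1,D_2]_2\varphi)$;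 - $[D_1,D_2]_i(\varphi\to\psi)\to([D_1,D_2]_i\varphi\to[D_1,D_2]_i\psi)$; - from $\varphi$ infer $[D_1,D_2]_i\varphi$. **Claim.** For each of these $\Lambda$ and every $\varphi\in\mathcal L_{\Box\ddagger}$: $\varphi$ is valid over the class of $\Lambda$-complying models if and only if $\varphi$ is derivable in $\Lambda+\mathrm{Ax}_{\Box\ddagger AM_D}$. -/

import Mathlib

universe u w

namespace Forget

/-! ### Propositional formulas, clauses and clausal forms -/

/-- Propositional formulas over the set `At` of atoms. -/
inductive PropForm (At : Type u) : Type u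
  | top : PropForm At
  | atom (p : At) : PropForm At
  | neg (a : PropForm At) : PropForm At
  | and (a b : PropForm At) : PropForm At

/-- Truth of a propositional formula under a classical valuation. -/
def PropForm.Holds {At : Type u} (v : At → Prop) : PropForm At → Prop
  | .top => True
  | .atom p => v p
  | .neg a => ¬ a.Holds v
  | .and a b => a.Holds v ∧ b.Holds v

/-- A literal is an atom or the negation of an atom. -/
inductive Literal (At : Type u) : Type u
  | pos (p : At) : Literal At
  | neg (p : At) : Literal At

def Literal.Holds {At : Type u} (v : At → Prop) : Literal At → Prop
  | .pos p => v p
  | .neg p => ¬ v p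

/-- A clause is a finite, possibly empty, set of literals. -/
abbrev Clause (At : Type u) : Type u := Finset (Literal At)

/-- Clauses are read disjunctively. -/
def Clause.Holds {At : Type u} (v : At → Prop) (D : Clause At) : Prop :=
  ∃ l ∈ D, l.Holds v

/-- A clause is tautological when it contains an atom together with its negation. -/
def Clause.Tautological {At : Type u} (D : Clause At) : Prop :=
  ∃ p : At, Literal.pos p ∈ D ∧ Literal.neg p ∈ D

/-- The non-tautological clauses. -/
abbrev NTClause (At : Type u) : Type u := {D : Clause At // ¬ Clause.Tautological D}

/-- `D` is a consequence of `a`, that is, `a → ⋁ D` is a tautology. -/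
def Clause.IsConsequence {At : Type u} (a : PropForm At) (D : Clause At) : Prop :=
  ∀ v : At → Prop, a.Holds v → Clause.Holds v D

/-- `D` is a consequence of `a` and no proper subclause of `D` is one. -/
def Clause.IsMinimalConsequence {At : Type u} (a : PropForm At) (D : Clause At) : Prop :=
  Clause.IsConsequence a D ∧ ∀ D' : Clause At, D' ⊂ D → ¬ Clause.IsConsequence a D'

/-- The clausal form `𝒞(a)`: all minimal non-tautological consequences of `a`. -/
def clausalForm {At : Type u} (a : PropForm At) : Set (NTClause At) :=
  {D | Clause.IsMinimalConsequence a D.1}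

/-- The atoms that occur in a propositional formula. -/
def PropForm.atoms {At : Type u} : PropForm At → Set At
  | .top => ∅
  | .atom p => {p}
  | .neg a => a.atoms
  | .and a b => a.atoms ∪ b.atoms

theorem PropForm.atoms_finite {At : Type u} (a : PropForm At) : a.atoms.Finite := by
  induction a with
  | top => exact Set.finite_empty
  | atom p => exact Set.finite_singleton p
  | neg a ih => exact ih
  | and a b iha ihb => exact iha.union ihb

theorem PropForm.holds_congr {At : Type u} (v v' : At → Prop) (a : PropForm At)
    (h : ∀ p ∈ a.atoms, (v p ↔ v' p)) : a.Holds v ↔ a.Holds v' := by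
  induction a with
  | top => exact Iff.rfl
  | atom p => exact h p rfl
  | neg a ih => exact not_congr (ih h)
  | and a b iha ihb =>
    exact and_congr (iha fun p hp => h p (Or.inl hp)) (ihb fun p hp => h p (Or.inr hp))

def Literal.atm {At : Type u} : Literal At → At
  | .pos p => p
  | .neg p => p

/-- A minimal non-tautological consequence of `a` mentions only atoms of `a`. -/
theorem atm_mem_atoms {At : Type u} {a : PropForm At} {D : NTClause At}
    (hD : D ∈ clausalForm a) {l : Literal At} (hl : l ∈ D.1) : l.atm ∈ a.atoms := by
  classical
  by_contra hn
  refine hD.2 (D.1.erase l) (Finset.erase_ssubset hl) ?_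
  intro v hv
  by_contra hno
  -- the valuation that agrees with `v` except that it falsifies `l`
  let v' : At → Prop := fun q => if q = l.atm then l = Literal.neg q else v q
  have hv' : a.Holds v' := by
    refine (PropForm.holds_congr v v' a fun p hp => ?_).1 hv
    have : p ≠ l.atm := fun h => hn (h ▸ hp)
    simp [v', this]
  obtain ⟨m, hm, hmv⟩ := hD.1 v' hv'
  by_cases hml : m.atm = l.atm
  · cases m with
    | pos q =>
      have hq : q = l.atm := hml
      have h2 : l = Literal.neg q := by
        have : v' q := hmv
        simpa [v', hq] using this
      exact D.2 ⟨q, hm, h2 ▸ hl⟩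
    | neg q =>
      have hq : q = l.atm := hml
      have h2 : ¬ l = Literal.neg q := by
        have : ¬ v' q := hmv
        simpa [v', hq] using this
      cases l with
      | pos r =>
        have hr : q = r := hq
        subst hr
        exact D.2 ⟨q, hl, hm⟩
      | neg r =>
        have hr : q = r := hq
        exact h2 (by rw [hr])
  · refine hno ⟨m, Finset.mem_erase.2 ⟨fun h => hml (by rw [h]), hm⟩, ?_⟩
    cases m with
    | pos q =>
      have hq : q ≠ l.atm := hml
      have : v' q := hmv
      simpa [v', hq, Literal.Holds] using this
    | neg q =>
      have hq : q ≠ l.atm := hml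
      have : ¬ v' q := hmv
      simpa [v', hq, Literal.Holds] using this

theorem clausalForm_finite {At : Type u} (a : PropForm At) : (clausalForm a).Finite := by
  have hL : {l : Literal At | l.atm ∈ a.atoms}.Finite := by
    refine ((a.atoms_finite.image Literal.pos).union (a.atoms_finite.image Literal.neg)).subset ?_
    intro l hl
    cases l with
    | pos p => exact Or.inl ⟨p, hl, rfl⟩
    | neg p => exact Or.inr ⟨p, hl, rfl⟩
  have hS : {S : Finset (Literal At) | S ⊆ hL.toFinset}.Finite := by
    refine (Finset.finite_toSet hL.toFinset.powerset).subset ?_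
    intro S hS
    simpa using hS
  refine Set.Finite.of_finite_image (f := Subtype.val) (hS.subset ?_)
    Subtype.val_injective.injOn
  rintro _ ⟨D, hD, rfl⟩ l hl
  simpa using atm_mem_atoms hD hl

/-- The clauses of `𝒞(a)`, listed without repetition. -/
noncomputable def clauseList {At : Type u} (a : PropForm At) : List (NTClause At) :=
  (clausalForm_finite a).toFinset.toList

theorem mem_clauseList {At : Type u} (a : PropForm At) (D : NTClause At) :
    D ∈ clauseList a ↔ D ∈ clausalForm a := by
  simp [clauseList]

/-! ### The language -/

/-- The three indices `0`, `1`, `2`, represented by `none`, `some 0`, `some 1`. -/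
abbrev Idx : Type := Option (Fin 2)

/-- The language with `□`, the forgetting modalities `[‡a]` (`a` propositional), and the auxiliary
modalities `[D₁, D₂]ᵢ` for the pointed action models `(U_{D₁,D₂}, eᵢ)`, with `i ∈ {0, 1, 2}` and
`D₁`, `D₂` non-tautological clauses. -/
inductive Formula (At : Type u) : Type u
  | top : Formula At
  | atom (p : At) : Formula At
  | neg (φ : Formula At) : Formula At
  | and (φ ψ : Formula At) : Formula At
  | box (φ : Formula At) : Formula At
  | forget (a : PropForm At) (φ : Formula At) : Formula At
  | act (D₁ D₂ : NTClause At) (i : Idx) (φ : Formula At) : Formula At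

namespace Formula

variable {At : Type u}

def bot : Formula At := .neg .top

def imp (φ ψ : Formula At) : Formula At := .neg (.and φ (.neg ψ))

def iff (φ ψ : Formula At) : Formula At := .and (imp φ ψ) (imp ψ φ)

/-- Finite conjunctions; the empty one is `⊤`. -/
def bigAnd : List (Formula At) → Formula At
  | [] => .top
  | φ :: l => .and φ (bigAnd l)

/-- The formulas of the language with `□` and `[‡a]` only, i.e. those in which no auxiliary
modality `[D₁, D₂]ᵢ` occurs. -/
def InForgetLanguage : Formula At → Prop
  | .top => True
  | .atom _ => True
  | .neg φ => φ.InForgetLanguage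
  | .and φ ψ => φ.InForgetLanguage ∧ ψ.InForgetLanguage
  | .box φ => φ.InForgetLanguage
  | .forget _ φ => φ.InForgetLanguage
  | .act _ _ _ _ => False

/-- Truth of a formula under an assignment of truth values to the formulas whose main operator is
not a Boolean connective. -/
def BoolHolds (v : Formula At → Prop) : Formula At → Prop
  | .top => True
  | .neg φ => ¬ φ.BoolHolds v
  | .and φ ψ => φ.BoolHolds v ∧ ψ.BoolHolds v
  | φ => v φ

/-- (Instances of) propositional tautologies. -/
def IsTautology (φ : Formula At) : Prop := ∀ v : Formula At → Prop, φ.BoolHolds v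

end Formula

/-! ### Models and satisfaction -/

/-- Kripke models. -/
structure Model (At : Type u) : Type (max u (w + 1)) where
  W : Type w
  nonempty : Nonempty W
  R : W → W → Prop
  V : At → Set W

/-- The model `M_u^𝒞` for the family `𝒞 = {Dᵢ : i ∈ I}` of non-tautological clauses. The index `0`,
which is not in `I`, is represented by `none`. -/
def Model.update {At : Type u} (M : Model.{u, w} At) {I : Type} (D : I → NTClause At) :
    Model.{u, w} At where
  W := M.W × Option I
  nonempty := M.nonempty.map fun x => (x, none)
  R x y := M.R x.1 y.1
  V p := {x | match x with
    | (x₀, none) => x₀ ∈ M.V p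
    | (x₀, some i) => Literal.neg p ∈ (D i).1 ∨
        ((Literal.pos p ∉ (D i).1 ∧ Literal.neg p ∉ (D i).1) ∧ x₀ ∈ M.V p)}

/-- The satisfaction relation. -/
def Sat {At : Type u} : (M : Model.{u, w} At) → M.W → Formula At → Prop
  | _, _, .top => True
  | M, x, .atom p => x ∈ M.V p
  | M, x, .neg φ => ¬ Sat M x φ
  | M, x, .and φ ψ => Sat M x φ ∧ Sat M x ψ
  | M, x, .box φ => ∀ y : M.W, M.R x y → Sat M y φ
  | M, x, .forget a φ => ∀ D₁ ∈ clausalForm a, ∀ D₂ ∈ clausalForm (PropForm.neg a),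
      Sat (M.update ![D₁, D₂]) (x, none) φ
  | M, x, .act D₁ D₂ i φ => Sat (M.update ![D₁, D₂]) (x, i) φ

/-! ### The modal logics and the axiom system -/

/-- The modal logics under consideration. -/
inductive ModalLogic : Type
  | K | T | K4 | K5 | S4 | S5

/-- `M` is a `Λ`-complying model: its relation is in the class of relations of `Λ`. -/
def ModalLogic.Complies {At : Type u} (L : ModalLogic) (M : Model.{u, w} At) : Prop :=
  match L with
  | .K => True
  | .T => ∀ x, M.R x x
  | .K4 => ∀ x y z, M.R x y → M.R y z → M.R x z
  | .K5 => ∀ x y z, M.R x y → M.R x z → M.R y z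
  | .S4 => (∀ x, M.R x x) ∧ ∀ x y z, M.R x y → M.R y z → M.R x z
  | .S5 => Equivalence M.R

/-- Validity over the class of `Λ`-complying models. -/
def ModalLogic.Valid {At : Type u} (L : ModalLogic) (φ : Formula At) : Prop :=
  ∀ M : Model.{u, w} At, L.Complies M → ∀ x : M.W, Sat M x φ

/-- `Λ` has the axiom `□φ → φ`. -/
def ModalLogic.HasT : ModalLogic → Prop
  | .T | .S4 | .S5 => True
  | _ => False

/-- `Λ` has the axiom `□φ → □□φ`. -/
def ModalLogic.HasFour : ModalLogic → Prop
  | .K4 | .S4 | .S5 => True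
  | _ => False

/-- `Λ` has the axiom `¬□φ → □¬□φ`. -/
def ModalLogic.HasFive : ModalLogic → Prop
  | .K5 | .S5 => True
  | _ => False

open Formula in
/-- Derivability in `Λ` together with the axioms and rules for forgetting and for the auxiliary
modalities. -/
inductive ModalLogic.Derivable {At : Type u} (L : ModalLogic) : Formula At → Prop
  -- the modal logic `Λ`
  | taut (φ : Formula At) : IsTautology φ → L.Derivable φ
  | modusPonens (φ ψ : Formula At) : L.Derivable (imp φ ψ) → L.Derivable φ → L.Derivable ψ
  | boxDistr (φ ψ : Formula At) :
      L.Derivable (imp (box (imp φ ψ)) (imp (box φ) (box ψ)))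
  | boxNec (φ : Formula At) : L.Derivable φ → L.Derivable (box φ)
  | axT (φ : Formula At) : L.HasT → L.Derivable (imp (box φ) φ)
  | axFour (φ : Formula At) : L.HasFour → L.Derivable (imp (box φ) (box (box φ)))
  | axFive (φ : Formula At) : L.HasFive →
      L.Derivable (imp (neg (box φ)) (box (neg (box φ))))
  -- forgetting
  | forget (a : PropForm At) (φ : Formula At) :
      L.Derivable (iff (forget a φ)
        (bigAnd ((clauseList a).map fun D₁ =>
          bigAnd ((clauseList (PropForm.neg a)).map fun D₂ => act D₁ D₂ none φ))))
  -- atoms at the index `0`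
  | actAtomZero (D₁ D₂ : NTClause At) (p : At) :
      L.Derivable (iff (act D₁ D₂ none (atom p)) (atom p))
  -- atoms at the index `1`
  | actAtomOne (D₁ D₂ : NTClause At) (p : At) :
      Literal.pos p ∉ D₁.1 → Literal.neg p ∉ D₁.1 →
      L.Derivable (iff (act D₁ D₂ (some 0) (atom p)) (atom p))
  | actAtomOneTop (D₁ D₂ : NTClause At) (p : At) : Literal.neg p ∈ D₁.1 →
      L.Derivable (iff (act D₁ D₂ (some 0) (atom p)) top)
  | actAtomOneBot (D₁ D₂ : NTClause At) (p : At) : Literal.pos p ∈ D₁.1 →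
      L.Derivable (iff (act D₁ D₂ (some 0) (atom p)) bot)
  -- atoms at the index `2`
  | actAtomTwo (D₁ D₂ : NTClause At) (p : At) :
      Literal.pos p ∉ D₂.1 → Literal.neg p ∉ D₂.1 →
      L.Derivable (iff (act D₁ D₂ (some 1) (atom p)) (atom p))
  | actAtomTwoTop (D₁ D₂ : NTClause At) (p : At) : Literal.neg p ∈ D₂.1 →
      L.Derivable (iff (act D₁ D₂ (some 1) (atom p)) top)
  | actAtomTwoBot (D₁ D₂ : NTClause At) (p : At) : Literal.pos p ∈ D₂.1 →
      L.Derivable (iff (act D₁ D₂ (some 1) (atom p)) bot)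
  -- complex formulas, at any index
  | actNeg (D₁ D₂ : NTClause At) (i : Idx) (φ : Formula At) :
      L.Derivable (iff (act D₁ D₂ i (neg φ)) (neg (act D₁ D₂ i φ)))
  | actAnd (D₁ D₂ : NTClause At) (i : Idx) (φ ψ : Formula At) :
      L.Derivable (iff (act D₁ D₂ i (and φ ψ)) (and (act D₁ D₂ i φ) (act D₁ D₂ i ψ)))
  | actBox (D₁ D₂ : NTClause At) (i : Idx) (φ : Formula At) :
      L.Derivable (iff (act D₁ D₂ i (box φ))
        (box (and (and (act D₁ D₂ none φ) (act D₁ D₂ (some 0) φ)) (act D₁ D₂ (some 1) φ))))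
  | actDistr (D₁ D₂ : NTClause At) (i : Idx) (φ ψ : Formula At) :
      L.Derivable (imp (act D₁ D₂ i (imp φ ψ)) (imp (act D₁ D₂ i φ) (act D₁ D₂ i ψ)))
  | actNec (D₁ D₂ : NTClause At) (i : Idx) (φ : Formula At) :
      L.Derivable φ → L.Derivable (act D₁ D₂ i φ)

end Forget

/-!
Soundness is checked axiom by axiom (`sat_of_derivable`); it rests on the fact that the product
update relates two pairs exactly when it relates their first components, so that it preserves every
frame class under consideration (`complies_update`).

For completeness, the reduction axioms push an auxiliary modality `[D₁, D₂]ᵢ` inwards through a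
purely modal formula until it disappears at the atoms (`reducible_act`). Necessitation and
distribution for `□` and for `[D₁, D₂]ᵢ` allow equivalents to be replaced below these modalities,
and `[‡a]` is a finite conjunction of auxiliary modalities; hence every formula is provably
equivalent to a purely modal one (`reducible`). For purely modal formulas the truth lemma
(`sat_canonicalModel_iff`) holds in the canonical model of the *whole* system, whose worlds are the
complete theories and whose frame is in the class of `Λ` because of the axioms `T`, `4` and `5`.

Theories here are sets that contain the derivable formulas and are closed under modus ponens. With
this notion the deduction theorem is the observation that `{ψ | χ → ψ ∈ S}` is again a theory, and
the set `{χ | □χ ∈ S}` used for `□` is one too, so finite derivations from premises never appear.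

Worlds of models live in a universe unrelated to that of the atoms. Since there are only countably
many formulas, the set of all complete theories is small in every universe, and the canonical model
can be transported to the required one.
-/

namespace Forget

variable {At : Type u}

/-! ### Soundness -/

theorem boolHolds_sat (M : Model.{u, w} At) (x : M.W) (φ : Formula At) :
    φ.BoolHolds (Sat M x) ↔ Sat M x φ := by
  induction φ with
  | neg φ ih => simp only [Formula.BoolHolds, Sat, ih]
  | and φ ψ ih₁ ih₂ => simp only [Formula.BoolHolds, Sat, ih₁, ih₂]
  | _ => simp only [Formula.BoolHolds, Sat]

theorem sat_imp (M : Model.{u, w} At) (x : M.W) (φ ψ : Formula At) :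
    Sat M x (.imp φ ψ) ↔ (Sat M x φ → Sat M x ψ) := by
  simp only [Formula.imp, Sat]; tauto

theorem sat_iff (M : Model.{u, w} At) (x : M.W) (φ ψ : Formula At) :
    Sat M x (.iff φ ψ) ↔ (Sat M x φ ↔ Sat M x ψ) := by
  simp only [Formula.iff, Sat, sat_imp]; tauto

theorem sat_bigAnd (M : Model.{u, w} At) (x : M.W) (l : List (Formula At)) :
    Sat M x (.bigAnd l) ↔ ∀ φ ∈ l, Sat M x φ := by
  induction l with
  | nil => simp [Formula.bigAnd, Sat]
  | cons φ l ih => simp [Formula.bigAnd, Sat, ih]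

theorem sat_act_none_atom (M : Model.{u, w} At) (x : M.W) (D₁ D₂ : NTClause At) (p : At) :
    Sat M x (.act D₁ D₂ none (.atom p)) ↔ x ∈ M.V p :=
  Iff.rfl

theorem sat_act_some_atom (M : Model.{u, w} At) (x : M.W) (D₁ D₂ : NTClause At) (i : Fin 2)
    (p : At) : Sat M x (.act D₁ D₂ (some i) (.atom p)) ↔
      Literal.neg p ∈ (![D₁, D₂] i).1 ∨
        ((Literal.pos p ∉ (![D₁, D₂] i).1 ∧ Literal.neg p ∉ (![D₁, D₂] i).1) ∧ x ∈ M.V p) :=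
  Iff.rfl

theorem complies_update (L : ModalLogic) (M : Model.{u, w} At) {I : Type} (D : I → NTClause At)
    (h : L.Complies M) : L.Complies (M.update D) := by
  cases L with
  | K => trivial
  | T => exact fun x => h x.1
  | K4 => exact fun x y z => h x.1 y.1 z.1
  | K5 => exact fun x y z => h x.1 y.1 z.1
  | S4 => exact ⟨fun x => h.1 x.1, fun x y z => h.2 x.1 y.1 z.1⟩
  | S5 => exact ⟨fun x => h.refl x.1, fun hxy => h.symm hxy, fun hxy hyz => h.trans hxy hyz⟩

theorem ModalLogic.Complies.refl {L : ModalLogic} {M : Model.{u, w} At} (h : L.Complies M)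
    (hL : L.HasT) (x : M.W) : M.R x x := by
  cases L with
  | T => exact h x
  | S4 => exact h.1 x
  | S5 => exact Equivalence.refl h x
  | _ => exact hL.elim

theorem ModalLogic.Complies.trans {L : ModalLogic} {M : Model.{u, w} At} (h : L.Complies M)
    (hL : L.HasFour) {x y z : M.W} (hxy : M.R x y) (hyz : M.R y z) : M.R x z := by
  cases L with
  | K4 => exact h x y z hxy hyz
  | S4 => exact h.2 x y z hxy hyz
  | S5 => exact Equivalence.trans h hxy hyz
  | _ => exact hL.elim

theorem ModalLogic.Complies.eucl {L : ModalLogic} {M : Model.{u, w} At} (h : L.Complies M)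
    (hL : L.HasFive) {x y z : M.W} (hxy : M.R x y) (hxz : M.R x z) : M.R y z := by
  cases L with
  | K5 => exact h x y z hxy hxz
  | S5 => exact Equivalence.trans h (Equivalence.symm h hxy) hxz
  | _ => exact hL.elim

theorem sat_of_derivable {L : ModalLogic} {φ : Formula At} (h : L.Derivable φ)
    (M : Model.{u, w} At) (hM : L.Complies M) (x : M.W) : Sat M x φ := by
  induction h generalizing M with
  | taut φ hφ => exact (boolHolds_sat M x φ).1 (hφ _)
  | modusPonens φ ψ _ _ ih₁ ih₂ => exact (sat_imp M x φ ψ).1 (ih₁ M hM x) (ih₂ M hM x)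
  | boxDistr φ ψ =>
    simp only [sat_imp, Sat]
    exact fun h₁ h₂ y hy => h₁ y hy (h₂ y hy)
  | boxNec φ _ ih => exact fun y _ => ih M hM y
  | axT φ hL =>
    simp only [sat_imp, Sat]
    exact fun h => h x (hM.refl hL x)
  | axFour φ hL =>
    simp only [sat_imp, Sat]
    exact fun h y hy z hz => h z (hM.trans hL hy hz)
  | axFive φ hL =>
    simp only [sat_imp, Sat]
    exact fun h y hy hz => h fun z hxz => hz z (hM.eucl hL hy hxz)
  | forget a φ =>
    simp only [sat_iff, sat_bigAnd, Sat, List.mem_map, forall_exists_index, and_imp,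
      forall_apply_eq_imp_iff₂, mem_clauseList]
  | actAtomZero D₁ D₂ p => rw [sat_iff, sat_act_none_atom, Sat]
  | actAtomOne D₁ D₂ p h₁ h₂ => rw [sat_iff, sat_act_some_atom]; simp [Sat, h₁, h₂]
  | actAtomOneTop D₁ D₂ p h => rw [sat_iff, sat_act_some_atom]; simp [Sat, h]
  | actAtomOneBot D₁ D₂ p h =>
    have h' : Literal.neg p ∉ D₁.1 := fun h' => D₁.2 ⟨p, h, h'⟩
    rw [sat_iff, sat_act_some_atom]; simp [Formula.bot, Sat, h, h']
  | actAtomTwo D₁ D₂ p h₁ h₂ => rw [sat_iff, sat_act_some_atom]; simp [Sat, h₁, h₂]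
  | actAtomTwoTop D₁ D₂ p h => rw [sat_iff, sat_act_some_atom]; simp [Sat, h]
  | actAtomTwoBot D₁ D₂ p h =>
    have h' : Literal.neg p ∉ D₂.1 := fun h' => D₂.2 ⟨p, h, h'⟩
    rw [sat_iff, sat_act_some_atom]; simp [Formula.bot, Sat, h, h']
  | actNeg D₁ D₂ i φ => simp only [sat_iff, Sat]
  | actAnd D₁ D₂ i φ ψ => simp only [sat_iff, Sat]
  | actBox D₁ D₂ i φ =>
    simp only [sat_iff, Sat]
    constructor
    · exact fun h y hy => ⟨⟨h (y, none) hy, h (y, some 0) hy⟩, h (y, some 1) hy⟩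
    · rintro h ⟨y, j⟩ hy
      match j with
      | none => exact (h y hy).1.1
      | some 0 => exact (h y hy).1.2
      | some 1 => exact (h y hy).2
  | actDistr D₁ D₂ i φ ψ => simp only [sat_imp, Sat]; exact (sat_imp _ _ φ ψ).1
  | actNec D₁ D₂ i φ _ ih => exact ih _ (complies_update L M _ hM) (x, i)

/-! ### Derived rules -/

section Rules

variable {L : ModalLogic} {φ ψ χ : Formula At}

theorem boolHolds_imp (v : Formula At → Prop) :
    (Formula.imp φ ψ).BoolHolds v ↔ (φ.BoolHolds v → ψ.BoolHolds v) := by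
  simp only [Formula.imp, Formula.BoolHolds]; tauto

theorem boolHolds_iff (v : Formula At → Prop) :
    (Formula.iff φ ψ).BoolHolds v ↔ (φ.BoolHolds v ↔ ψ.BoolHolds v) := by
  simp only [Formula.iff, Formula.BoolHolds, boolHolds_imp]; tauto

namespace ModalLogic.Derivable

theorem of_bool₁ (h : L.Derivable φ)
    (hv : ∀ v : Formula At → Prop, φ.BoolHolds v → ψ.BoolHolds v) : L.Derivable ψ :=
  .modusPonens φ ψ (.taut _ fun v => (boolHolds_imp v).2 (hv v)) h

theorem of_bool₂ (h₁ : L.Derivable φ) (h₂ : L.Derivable ψ)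
    (hv : ∀ v : Formula At → Prop, φ.BoolHolds v → ψ.BoolHolds v → χ.BoolHolds v) :
    L.Derivable χ :=
  .modusPonens ψ χ (h₁.of_bool₁ fun v h => (boolHolds_imp v).2 (hv v h)) h₂

theorem iff_refl (φ : Formula At) : L.Derivable (.iff φ φ) :=
  .taut _ fun v => (boolHolds_iff v).2 Iff.rfl

theorem iff_trans (h₁ : L.Derivable (.iff φ ψ)) (h₂ : L.Derivable (.iff ψ χ)) :
    L.Derivable (.iff φ χ) :=
  h₁.of_bool₂ h₂ fun v => by simp only [boolHolds_iff]; exact Iff.trans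

theorem iff_mp (h : L.Derivable (.iff φ ψ)) : L.Derivable (.imp φ ψ) :=
  h.of_bool₁ fun v => by simp only [boolHolds_iff, boolHolds_imp]; exact Iff.mp

theorem iff_mpr (h : L.Derivable (.iff φ ψ)) : L.Derivable (.imp ψ φ) :=
  h.of_bool₁ fun v => by simp only [boolHolds_iff, boolHolds_imp]; exact Iff.mpr

theorem iff_intro (h₁ : L.Derivable (.imp φ ψ)) (h₂ : L.Derivable (.imp ψ φ)) :
    L.Derivable (.iff φ ψ) :=
  h₁.of_bool₂ h₂ fun v => by simp only [boolHolds_iff, boolHolds_imp]; exact Iff.intro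

theorem iff_neg (h : L.Derivable (.iff φ ψ)) : L.Derivable (.iff (.neg φ) (.neg ψ)) :=
  h.of_bool₁ fun v => by simp only [boolHolds_iff, Formula.BoolHolds]; exact not_congr

theorem iff_and {φ' ψ' : Formula At} (h₁ : L.Derivable (.iff φ φ'))
    (h₂ : L.Derivable (.iff ψ ψ')) : L.Derivable (.iff (.and φ ψ) (.and φ' ψ')) :=
  h₁.of_bool₂ h₂ fun v => by simp only [boolHolds_iff, Formula.BoolHolds]; exact and_congr

theorem imp_box (h : L.Derivable (.imp φ ψ)) : L.Derivable (.imp (.box φ) (.box ψ)) :=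
  .modusPonens _ _ (.boxDistr φ ψ) (.boxNec _ h)

theorem iff_box (h : L.Derivable (.iff φ ψ)) : L.Derivable (.iff (.box φ) (.box ψ)) :=
  h.iff_mp.imp_box.iff_intro h.iff_mpr.imp_box

theorem imp_act (D₁ D₂ : NTClause At) (i : Idx) (h : L.Derivable (.imp φ ψ)) :
    L.Derivable (.imp (.act D₁ D₂ i φ) (.act D₁ D₂ i ψ)) :=
  .modusPonens _ _ (.actDistr D₁ D₂ i φ ψ) (.actNec D₁ D₂ i _ h)

theorem iff_act (D₁ D₂ : NTClause At) (i : Idx) (h : L.Derivable (.iff φ ψ)) :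
    L.Derivable (.iff (.act D₁ D₂ i φ) (.act D₁ D₂ i ψ)) :=
  (h.iff_mp.imp_act D₁ D₂ i).iff_intro (h.iff_mpr.imp_act D₁ D₂ i)

end ModalLogic.Derivable

end Rules

/-! ### Reduction to purely modal formulas -/

/-- The formulas of the basic modal language, in which neither `[‡a]` nor `[D₁, D₂]ᵢ` occurs. -/
def Formula.IsModal : Formula At → Prop
  | .top => True
  | .atom _ => True
  | .neg φ => φ.IsModal
  | .and φ ψ => φ.IsModal ∧ ψ.IsModal
  | .box φ => φ.IsModal
  | .forget _ _ => False
  | .act _ _ _ _ => False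

/-- `φ` is provably equivalent to a purely modal formula. -/
def Reducible (L : ModalLogic) (φ : Formula At) : Prop :=
  ∃ ψ : Formula At, ψ.IsModal ∧ L.Derivable (.iff φ ψ)

section Reduction

variable {L : ModalLogic} {φ ψ : Formula At}

theorem Formula.IsModal.reducible (h : φ.IsModal) : Reducible L φ :=
  ⟨φ, h, .iff_refl φ⟩

theorem Reducible.of_iff (h : L.Derivable (.iff φ ψ)) (hψ : Reducible L ψ) : Reducible L φ :=
  let ⟨χ, hχ, e⟩ := hψ
  ⟨χ, hχ, h.iff_trans e⟩

theorem Reducible.neg (h : Reducible L φ) : Reducible L (.neg φ) :=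
  let ⟨χ, hχ, e⟩ := h
  ⟨.neg χ, hχ, e.iff_neg⟩

theorem Reducible.and (h₁ : Reducible L φ) (h₂ : Reducible L ψ) : Reducible L (.and φ ψ) :=
  let ⟨χ₁, hχ₁, e₁⟩ := h₁
  let ⟨χ₂, hχ₂, e₂⟩ := h₂
  ⟨.and χ₁ χ₂, ⟨hχ₁, hχ₂⟩, e₁.iff_and e₂⟩

theorem Reducible.box (h : Reducible L φ) : Reducible L (.box φ) :=
  let ⟨χ, hχ, e⟩ := h
  ⟨.box χ, hχ, e.iff_box⟩

theorem Reducible.bigAnd {l : List (Formula At)} (h : ∀ φ ∈ l, Reducible L φ) :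
    Reducible L (.bigAnd l) := by
  induction l with
  | nil => exact Formula.IsModal.reducible (φ := .top) trivial
  | cons φ l ih =>
    exact (h φ (by simp)).and (ih fun ψ hψ => h ψ (by simp [hψ]))

theorem reducible_top : Reducible L (.top : Formula At) :=
  Formula.IsModal.reducible (φ := .top) trivial

theorem reducible_atom (p : At) : Reducible L (.atom p) :=
  Formula.IsModal.reducible (φ := .atom p) trivial

theorem reducible_act_atom (D₁ D₂ : NTClause At) (i : Idx) (p : At) :
    Reducible L (.act D₁ D₂ i (.atom p)) := by
  match i with
  | none => exact .of_iff (.actAtomZero D₁ D₂ p) (reducible_atom p)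
  | some 0 =>
    by_cases hn : Literal.neg p ∈ D₁.1
    · exact .of_iff (.actAtomOneTop D₁ D₂ p hn) reducible_top
    by_cases hp : Literal.pos p ∈ D₁.1
    · exact .of_iff (.actAtomOneBot D₁ D₂ p hp) reducible_top.neg
    exact .of_iff (.actAtomOne D₁ D₂ p hp hn) (reducible_atom p)
  | some 1 =>
    by_cases hn : Literal.neg p ∈ D₂.1
    · exact .of_iff (.actAtomTwoTop D₁ D₂ p hn) reducible_top
    by_cases hp : Literal.pos p ∈ D₂.1
    · exact .of_iff (.actAtomTwoBot D₁ D₂ p hp) reducible_top.neg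
    exact .of_iff (.actAtomTwo D₁ D₂ p hp hn) (reducible_atom p)

theorem reducible_act (D₁ D₂ : NTClause At) (i : Idx) (hφ : φ.IsModal) :
    Reducible L (.act D₁ D₂ i φ) := by
  induction φ generalizing i with
  | top =>
    -- no axiom treats `⊤`, but `[D₁, D₂]ᵢ ⊤` follows by necessitation
    have h : L.Derivable (.act D₁ D₂ i (.top : Formula At)) :=
      .actNec D₁ D₂ i _ (.taut _ fun _ => trivial)
    refine ⟨.top, trivial, h.of_bool₁ fun v hv => (boolHolds_iff v).2 ?_⟩
    exact ⟨fun _ => trivial, fun _ => hv⟩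
  | atom p => exact reducible_act_atom D₁ D₂ i p
  | neg φ ih => exact .of_iff (.actNeg D₁ D₂ i φ) (ih i hφ).neg
  | and φ ψ ih₁ ih₂ =>
    exact .of_iff (.actAnd D₁ D₂ i φ ψ) ((ih₁ i hφ.1).and (ih₂ i hφ.2))
  | box φ ih =>
    exact .of_iff (.actBox D₁ D₂ i φ) (((ih none hφ).and (ih (some 0) hφ)).and (ih (some 1) hφ)).box
  | forget a φ => exact hφ.elim
  | act E₁ E₂ j φ => exact hφ.elim

theorem Reducible.act (D₁ D₂ : NTClause At) (i : Idx) (h : Reducible L φ) :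
    Reducible L (.act D₁ D₂ i φ) :=
  let ⟨_, hχ, e⟩ := h
  .of_iff (e.iff_act D₁ D₂ i) (reducible_act D₁ D₂ i hχ)

theorem reducible (φ : Formula At) : Reducible L φ := by
  induction φ with
  | top => exact reducible_top
  | atom p => exact reducible_atom p
  | neg φ ih => exact ih.neg
  | and φ ψ ih₁ ih₂ => exact ih₁.and ih₂
  | box φ ih => exact ih.box
  | forget a φ ih =>
    refine .of_iff (.forget a φ) (.bigAnd ?_)
    simp only [List.mem_map, forall_exists_index, and_imp, forall_apply_eq_imp_iff₂]
    intro D₁ _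
    refine .bigAnd ?_
    simp only [List.mem_map, forall_exists_index, and_imp, forall_apply_eq_imp_iff₂]
    exact fun D₂ _ => ih.act D₁ D₂ none
  | act D₁ D₂ i φ ih => exact ih.act D₁ D₂ i

end Reduction

/-! ### Theories and complete theories -/

/-- A theory contains every derivable formula and is closed under modus ponens (but not under
necessitation). The set of all formulas is a theory. -/
structure IsTheory (L : ModalLogic) (S : Set (Formula At)) : Prop where
  of_derivable : ∀ φ, L.Derivable φ → φ ∈ S
  mp : ∀ φ ψ, Formula.imp φ ψ ∈ S → φ ∈ S → ψ ∈ S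

/-- The complete (maximal consistent) theories, which are the worlds of the canonical model. -/
structure IsComplete (L : ModalLogic) (S : Set (Formula At)) : Prop extends IsTheory L S where
  neg_mem_iff : ∀ φ, Formula.neg φ ∈ S ↔ φ ∉ S

section Theories

variable {L : ModalLogic} {S : Set (Formula At)} {φ ψ χ : Formula At}

theorem isTheory_derivable (L : ModalLogic) : IsTheory L {φ : Formula At | L.Derivable φ} :=
  ⟨fun _ h => h, fun φ ψ h₁ h₂ => .modusPonens φ ψ h₁ h₂⟩

theorem IsTheory.mem_of_imp (hS : IsTheory L S) (h : L.Derivable (.imp φ ψ)) (hφ : φ ∈ S) :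
    ψ ∈ S :=
  hS.mp φ ψ (hS.of_derivable _ h) hφ

theorem IsTheory.mem_of_bool₁ (hS : IsTheory L S) (hφ : φ ∈ S)
    (hv : ∀ v : Formula At → Prop, φ.BoolHolds v → ψ.BoolHolds v) : ψ ∈ S :=
  hS.mem_of_imp (.taut _ fun v => (boolHolds_imp v).2 (hv v)) hφ

theorem IsTheory.mem_of_bool₂ (hS : IsTheory L S) (hφ : φ ∈ S) (hψ : ψ ∈ S)
    (hv : ∀ v : Formula At → Prop, φ.BoolHolds v → ψ.BoolHolds v → χ.BoolHolds v) : χ ∈ S :=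
  hS.mp ψ χ (hS.mem_of_bool₁ hφ fun v h => (boolHolds_imp v).2 (hv v h)) hψ

/-- The deduction theorem: the consequences of `χ` over a theory form a theory. -/
theorem IsTheory.adjoin (hS : IsTheory L S) (χ : Formula At) :
    IsTheory L {ψ | Formula.imp χ ψ ∈ S} where
  of_derivable ψ h := hS.mem_of_bool₁ (hS.of_derivable ψ h) fun v hv =>
    (boolHolds_imp v).2 fun _ => hv
  mp φ ψ h₁ h₂ := hS.mem_of_bool₂ h₁ h₂ fun v => by simp only [boolHolds_imp]; tauto

theorem IsTheory.unbox (hS : IsTheory L S) : IsTheory L {ψ | Formula.box ψ ∈ S} where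
  of_derivable ψ h := hS.of_derivable _ (.boxNec ψ h)
  mp φ ψ h₁ h₂ := hS.mp _ _ (hS.mem_of_imp (.boxDistr φ ψ) h₁) h₂

/-- Lindenbaum's lemma: a theory maximal among those that omit `φ` is complete. -/
theorem IsTheory.exists_isComplete (hS : IsTheory L S) (hφ : φ ∉ S) :
    ∃ T, IsComplete L T ∧ S ⊆ T ∧ φ ∉ T := by
  obtain ⟨T, hST, hT⟩ := zorn_subset_nonempty {T | IsTheory L T ∧ φ ∉ T} (by
    intro c hc hchain ⟨T₀, hT₀⟩
    refine ⟨⋃₀ c, ⟨⟨fun ψ h => ⟨T₀, hT₀, (hc hT₀).1.of_derivable ψ h⟩, ?_⟩, ?_⟩,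
      fun T hT => Set.subset_sUnion_of_mem hT⟩
    · rintro ψ χ ⟨T₁, hT₁, h₁⟩ ⟨T₂, hT₂, h₂⟩
      rcases hchain.total hT₁ hT₂ with h | h
      · exact ⟨T₂, hT₂, (hc hT₂).1.mp ψ χ (h h₁) h₂⟩
      · exact ⟨T₁, hT₁, (hc hT₁).1.mp ψ χ h₁ (h h₂)⟩
    · rintro ⟨T, hT, h⟩
      exact (hc hT).2 h) S ⟨hS, hφ⟩
  obtain ⟨hTth, hφT⟩ := hT.prop
  have key : ∀ χ, χ ∉ T → Formula.imp χ φ ∈ T := by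
    intro χ hχ
    by_contra hn
    refine hχ (hT.le_of_ge ⟨hTth.adjoin χ, hn⟩ (fun ψ hψ => ?_) ?_)
    · exact hTth.mem_of_bool₁ hψ fun v hv => (boolHolds_imp v).2 fun _ => hv
    · exact hTth.of_derivable _ (.taut _ fun v => (boolHolds_imp v).2 id)
  refine ⟨T, ⟨hTth, fun χ => ⟨fun h₁ h₂ => hφT ?_, fun h => ?_⟩⟩, hST, hφT⟩
  · exact hTth.mem_of_bool₂ h₁ h₂ fun v h₁ h₂ => absurd h₂ h₁
  · by_contra hn
    refine hφT (hTth.mem_of_bool₂ (key χ h) (key _ hn) fun v => ?_)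
    simp only [boolHolds_imp, Formula.BoolHolds]
    tauto

end Theories

/-! ### Countability of the language -/

/-- A numerical code of a formula, given codes of the atoms, of the propositional formulas and of
the clauses. -/
def Formula.code (f : At → ℕ) (g : PropForm At → ℕ) (h : NTClause At × NTClause At × Idx → ℕ) :
    Formula At → ℕ
  | .top => Nat.pair 0 0
  | .atom p => Nat.pair 1 (f p)
  | .neg φ => Nat.pair 2 (φ.code f g h)
  | .and φ ψ => Nat.pair 3 (Nat.pair (φ.code f g h) (ψ.code f g h))
  | .box φ => Nat.pair 4 (φ.code f g h)
  | .forget a φ => Nat.pair 5 (Nat.pair (g a) (φ.code f g h))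
  | .act D₁ D₂ i φ => Nat.pair 6 (Nat.pair (h (D₁, D₂, i)) (φ.code f g h))

theorem Formula.code_injective {f : At → ℕ} {g : PropForm At → ℕ}
    {h : NTClause At × NTClause At × Idx → ℕ} (hf : f.Injective) (hg : g.Injective)
    (hh : h.Injective) : (Formula.code f g h).Injective := by
  intro φ
  induction φ <;> intro ψ e <;> cases ψ <;>
    simp_all [Formula.code, Nat.pair_eq_pair, hf.eq_iff, hg.eq_iff, hh.eq_iff] <;> grind

/-- A numerical code of a propositional formula, given a code of the atoms. -/
def PropForm.code (f : At → ℕ) : PropForm At → ℕ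
  | .top => Nat.pair 0 0
  | .atom p => Nat.pair 1 (f p)
  | .neg a => Nat.pair 2 (a.code f)
  | .and a b => Nat.pair 3 (Nat.pair (a.code f) (b.code f))

theorem PropForm.code_injective {f : At → ℕ} (hf : f.Injective) :
    (PropForm.code f).Injective := by
  intro a
  induction a <;> intro b e <;> cases b <;>
    simp_all [PropForm.code, Nat.pair_eq_pair, hf.eq_iff] <;> grind

instance [Countable At] : Countable (PropForm At) :=
  let ⟨_, hf⟩ := exists_injective_nat At
  (PropForm.code_injective hf).countable

instance [Countable At] : Countable (Literal At) := by
  have : Function.Injective fun l : Literal At =>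
      (match l with | .pos p => .inl p | .neg p => .inr p : At ⊕ At) := by
    rintro (p | p) (q | q) <;> simp
  exact this.countable

instance [Countable At] : Countable (Formula At) := by
  obtain ⟨f, hf⟩ := exists_injective_nat At
  obtain ⟨g, hg⟩ := exists_injective_nat (PropForm At)
  obtain ⟨h, hh⟩ := exists_injective_nat (NTClause At × NTClause At × Idx)
  exact (Formula.code_injective hf hg hh).countable

/-! ### The canonical model -/

section Canonical

variable [Countable At] (L : ModalLogic)

/-- The complete theories, as a type in an arbitrary universe. -/
abbrev CanonicalWorld (L : ModalLogic) (At : Type u) [Countable At] : Type w :=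
  Shrink.{w} {S : Set (Formula At) // IsComplete L S}

variable {L} in
/-- The complete theory that a world of the canonical model stands for. -/
def CanonicalWorld.theory (x : CanonicalWorld.{u, w} L At) : Set (Formula At) :=
  ((equivShrink _).symm x).1

variable {L} in
theorem CanonicalWorld.isComplete (x : CanonicalWorld.{u, w} L At) : IsComplete L x.theory :=
  ((equivShrink _).symm x).2

variable {L} in
theorem exists_canonicalWorld {S : Set (Formula At)} (hS : IsTheory L S) {φ : Formula At}
    (hφ : φ ∉ S) : ∃ x : CanonicalWorld.{u, w} L At, S ⊆ x.theory ∧ φ ∉ x.theory := by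
  obtain ⟨T, hT, hST, hφT⟩ := hS.exists_isComplete hφ
  refine ⟨equivShrink _ ⟨T, hT⟩, ?_⟩
  simpa [CanonicalWorld.theory] using ⟨hST, hφT⟩

/-- The canonical model on the complete theories: `y` is accessible from `x` when it contains every
formula that is necessary at `x`. -/
def canonicalModel [h : Nonempty (CanonicalWorld.{u, w} L At)] : Model.{u, w} At where
  W := CanonicalWorld.{u, w} L At
  nonempty := h
  R x y := ∀ φ, Formula.box φ ∈ x.theory → φ ∈ y.theory
  V p := {x | .atom p ∈ x.theory}

variable [Nonempty (CanonicalWorld.{u, w} L At)]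

theorem canonicalModel_refl (hL : L.HasT) (x : (canonicalModel.{u, w} (At := At) L).W) :
    (canonicalModel L).R x x :=
  fun φ hφ => (CanonicalWorld.isComplete x).mem_of_imp (.axT φ hL) hφ

theorem canonicalModel_trans (hL : L.HasFour) (x y z : (canonicalModel.{u, w} (At := At) L).W)
    (hxy : (canonicalModel L).R x y) (hyz : (canonicalModel L).R y z) :
    (canonicalModel L).R x z :=
  fun φ hφ => hyz φ (hxy _ ((CanonicalWorld.isComplete x).mem_of_imp (.axFour φ hL) hφ))

theorem canonicalModel_eucl (hL : L.HasFive) (x y z : (canonicalModel.{u, w} (At := At) L).W)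
    (hxy : (canonicalModel L).R x y) (hxz : (canonicalModel L).R x z) :
    (canonicalModel L).R y z := by
  intro φ hφ
  refine hxz φ (by_contra fun hn => ?_)
  have hx := CanonicalWorld.isComplete x
  exact ((CanonicalWorld.isComplete y).neg_mem_iff _).1
    (hxy _ (hx.mem_of_imp (.axFive φ hL) ((hx.neg_mem_iff _).2 hn))) hφ

theorem complies_canonicalModel : L.Complies (canonicalModel.{u, w} (At := At) L) := by
  cases L with
  | K => trivial
  | T => exact canonicalModel_refl _ (by trivial)
  | K4 => exact canonicalModel_trans _ (by trivial)
  | K5 => exact canonicalModel_eucl _ (by trivial)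
  | S4 => exact ⟨canonicalModel_refl _ (by trivial), canonicalModel_trans _ (by trivial)⟩
  | S5 =>
    exact ⟨canonicalModel_refl _ (by trivial),
      fun {x y} h =>
        canonicalModel_eucl .S5 (by trivial) x y x h (canonicalModel_refl .S5 (by trivial) x),
      fun {x y z} => canonicalModel_trans .S5 (by trivial) x y z⟩

/-- The truth lemma for purely modal formulas. -/
theorem sat_canonicalModel_iff {φ : Formula At} (hφ : φ.IsModal)
    (x : CanonicalWorld.{u, w} L At) : Sat (canonicalModel L) x φ ↔ φ ∈ x.theory := by
  induction φ generalizing x with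
  | top => exact ⟨fun _ => x.isComplete.of_derivable _ (.taut _ fun _ => trivial), fun _ => trivial⟩
  | atom p => exact Iff.rfl
  | neg φ ih => exact (not_congr (ih hφ x)).trans (x.isComplete.neg_mem_iff φ).symm
  | and φ ψ ih₁ ih₂ =>
    refine (and_congr (ih₁ hφ.1 x) (ih₂ hφ.2 x)).trans ⟨fun h => ?_, fun h => ⟨?_, ?_⟩⟩
    · exact x.isComplete.mem_of_bool₂ h.1 h.2 fun _ => And.intro
    · exact x.isComplete.mem_of_bool₁ h fun _ => And.left
    · exact x.isComplete.mem_of_bool₁ h fun _ => And.right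
  | box φ ih =>
    constructor
    · intro h
      by_contra hn
      obtain ⟨y, hxy, hy⟩ := exists_canonicalWorld.{u, w} x.isComplete.unbox hn
      exact hy ((ih hφ y).1 (h y hxy))
    · exact fun h y hxy => (ih hφ y).2 (hxy φ h)
  | forget a φ => exact hφ.elim
  | act D₁ D₂ i φ => exact hφ.elim

end Canonical

/-- Completeness, for the whole language with `[‡a]` and the auxiliary modalities. -/
theorem derivable_of_valid [Countable At] (L : ModalLogic) (φ : Formula At)
    (h : ModalLogic.Valid.{u, w} L φ) : L.Derivable φ := by
  obtain ⟨ψ, hψ, e⟩ := reducible (L := L) φ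
  by_contra hn
  have hn' : ψ ∉ {χ : Formula At | L.Derivable χ} := fun hd => hn (.modusPonens _ _ e.iff_mpr hd)
  obtain ⟨x, -, hx⟩ := exists_canonicalWorld.{u, w} (isTheory_derivable L) hn'
  have : Nonempty (CanonicalWorld.{u, w} L At) := ⟨x⟩
  have hM := complies_canonicalModel.{u, w} (At := At) L
  have hs := (sat_iff (canonicalModel L) x φ ψ).1 (sat_of_derivable e _ hM x)
  exact hx ((sat_canonicalModel_iff L hψ x).1 (hs.1 (h _ hM x)))

end Forget

/-- A formula of the language with `□` and `[‡a]` is valid over the `Λ`-complying models iff it is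
derivable in `Λ` together with the axioms for forgetting and the auxiliary modalities. -/
theorem mainTheorem2 {At : Type u} [Countable At] [Nonempty At]
    (L : Forget.ModalLogic) (φ : Forget.Formula At) (hφ : φ.InForgetLanguage) :
    Forget.ModalLogic.Valid.{u, w} L φ ↔ L.Derivable φ :=
  ⟨Forget.derivable_of_valid L φ, fun h M hM x => Forget.sat_of_derivable h M hM x⟩
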